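/- Fix a set $\mathsf{AP}$ of atomic propositions (the literals are $p$ and $\neg p$ for $p\in\mathsf{AP}$) and an infinite set of propositional variables. $\mathcal L_\mu$ is the set of closed $\mu$-calculus formulas in positive form, built from $\top,\bot$, literals, variables, $\wedge,\vee,\Box,\Diamond,\nu X,\mu X$; $\mathcal L_\mu^\nu\subseteq\mathcal L_\mu$ is the set of those in which no $\mu$ occurs. A Kripke structure (KS) $K=\langle S,S^0,R,L\rangle$ has an arbitrary set $S$ of states, an arbitrary set $S^0\subseteq S$ of initial states, a transition relation $R\subseteq S\times S$ and a labelling $L$ of states by sets of literals containing exactly one of $p,\neg p$ for each $p$; $K\models\varphi$ means that $\varphi$ is true, in the standard semantics, in every initial state. Two formulas are semantically equivalent if they are satisfied by the same KSs; $[\mathcal L_\mu^\nu]_\equiv$ is the set of $\varphi\in\mathcal L_\mu$ semantically equivalent to some formula of $\mathcal L_\mu^\nu$. A GTS $M=\langle S,S^0,R^+,R^-,L\rangle$ has a finite set $S$ of states, initial states $S^0\subseteq S$, may transitions $R^-\subseteq S\times S$, must hypertransitions $R^+\subseteq S\times 2^S$ such that $s\,R^+A$ implies $s\,R^-t$ for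 all $t\in A$, and a labelling with at most one of $p,\neg p$ in each $L(s)$; $|M|=|S|$. $M\models^{SIS}\varphi$ (\emph{$M$ proves $\varphi$}) means that every initial state satisfies $\varphi$ in the inductive semantics in which $\Diamond U=\{s\mid\exists A\subseteq U.\ s\,R^+A\}$, $\Box U=\{s\mid\forall t.\ s\,R^-t\Rightarrow t\in U\}$, literals are true where they label, and $\mu,\nu$ are least and greatest fixpoints. A KS is viewed as a system of this form (without finiteness) by $R^-=R$ and $s\,R^+A$ iff $A=\{t\}$ with $s\,R\,t$. A mixed simulation between $M_1$ and $M_2$ is a relation $H\subseteq S_1\times S_2$ such that $s_1Hs_2$ implies: $L_2(s_2)\subseteq L_1(s_1)$; if $s_1R_1^-t_1$ then $s_2R_2^-t_2$ and $t_1Ht_2$ for some $t_2$; if $s_2R_2^+A_2$ then $s_1R_1^+A_1$ for some $A_1$ such that each $t_1\in A_1$ has some $t_2\in A_2$ with $t_1Ht_2$. Write $\langle M_1,s_1\rangle\le_{mix}\langle M_2,s_2\rangle$ if $s_1Hs_2$ for some mixed simulation $H$, and $M_1\le_{mix}M_2$ if for every $s_1\in S_1^0$ there is $s_2\in S^0_2$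 with $\langle M_1,s_1\rangle\le_{mix}\langle M_2,s_2\rangle$. Let $\mathbf{compl}$ be the set of $\varphi\in\mathcal L_\mu$ that are true in some state of some KS and such that, whenever $\varphi$ is true in a state $s$ of a KS $K$, there are a GTS $M$ and a state $t$ of $M$ with $\langle K,s\rangle\le_{mix}\langle M,t\rangle$ and $\varphi$ proved at $t$. Let $\mathbf{minmodel}(\varphi,K)=\inf\{|M| : M \text{ a GTS},\ K\le_{mix}M\models^{SIS}\varphi\}\in\mathbb N\cup\{\infty\}$ (with $\inf\emptyset=\infty$) if $\varphi\in\mathbf{compl}$, and $\mathbf{minmodel}(\varphi,K)=\infty$ otherwise; let $\mathbf{maxminmodel}(\varphi)=\sup\{\mathbf{minmodel}(\varphi,K) : K \text{ a KS},\ K\models\varphi\}$. \textbf{Lemma.} For every $\varphi\in\mathcal L_\mu\setminus[\mathcal L_\mu^\nu]_\equiv$ we have $\mathbf{maxminmodel}(\varphi)=\infty$. Moreover, whether or not $\varphi\in\mathbf{compl}$, no uniform bound on the size of the GTSs suffices: for every $n\in\mathbb N$ there is a KS $K$ with $K\models\varphi$ such that every GTS $M$ with $K\le_{mix}M\models^{SIS}\varphi$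 has $|M|>n$. -/

import Mathlib

universe u v w

namespace MuCalc

/-- Literals over the atomic propositions `AP`: `pos p` is `p`, `neg p` is `¬ p`. -/
inductive Lit (AP : Type v) : Type v
  | pos (p : AP)
  | neg (p : AP)

/-- Formulas of the modal `μ`-calculus in positive form, with propositional variables from `V`. -/
inductive Formula (AP : Type v) (V : Type w) : Type (max v w)
  | top
  | bot
  | lit (l : Lit AP)
  | var (X : V)
  | and (φ ψ : Formula AP V)
  | or (φ ψ : Formula AP V)
  | box (φ : Formula AP V)
  | dia (φ : Formula AP V)
  | nu (X : V) (φ : Formula AP V)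
  | mu (X : V) (φ : Formula AP V)

namespace Formula

variable {AP : Type v} {V : Type w}

/-- The set of free propositional variables. -/
def freeVars : Formula AP V → Set V
  | top => ∅
  | bot => ∅
  | lit _ => ∅
  | var X => {X}
  | and φ ψ => φ.freeVars ∪ ψ.freeVars
  | or φ ψ => φ.freeVars ∪ ψ.freeVars
  | box φ => φ.freeVars
  | dia φ => φ.freeVars
  | nu X φ => φ.freeVars \ {X}
  | mu X φ => φ.freeVars \ {X}

/-- A formula is closed if it has no free propositional variables. -/
def Closed (φ : Formula AP V) : Prop := φ.freeVars = ∅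

/-- No least fixpoint operator occurs in the formula. -/
def MuFree : Formula AP V → Prop
  | top => True
  | bot => True
  | lit _ => True
  | var _ => True
  | and φ ψ => φ.MuFree ∧ ψ.MuFree
  | or φ ψ => φ.MuFree ∧ ψ.MuFree
  | box φ => φ.MuFree
  | dia φ => φ.MuFree
  | nu _ φ => φ.MuFree
  | mu _ _ => False

end Formula

section FixedPoints

variable {S : Type u}

/-- Least fixpoint of a monotone operator on `2^S`, as the intersection of all pre-fixpoints. -/
def lfpSet (f : Set S → Set S) : Set S := ⋂₀ {U | f U ⊆ U}

/-- Greatest fixpoint of a monotone operator on `2^S`, as the union of all post-fixpoints. -/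
def gfpSet (f : Set S → Set S) : Set S := ⋃₀ {U | U ⊆ f U}

theorem lfpSet_mono {f g : Set S → Set S} (h : ∀ U, f U ⊆ g U) : lfpSet f ⊆ lfpSet g :=
  Set.sInter_subset_sInter fun U hU => (h U).trans hU

theorem gfpSet_mono {f g : Set S → Set S} (h : ∀ U, f U ⊆ g U) : gfpSet f ⊆ gfpSet g :=
  Set.sUnion_subset_sUnion fun U hU => Set.Subset.trans hU (h U)

theorem lfpSet_isLeast {f : Set S → Set S} (hf : Monotone f) :
    IsLeast {U | f U = U} (lfpSet f) :=
  ⟨(OrderHom.map_lfp ⟨f, hf⟩ :), fun _ hU => Set.sInter_subset_of_mem hU.le⟩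

theorem gfpSet_isGreatest {f : Set S → Set S} (hf : Monotone f) :
    IsGreatest {U | f U = U} (gfpSet f) :=
  ⟨(OrderHom.map_gfp ⟨f, hf⟩ :), fun _ hU => Set.subset_sUnion_of_mem hU.ge⟩

end FixedPoints

namespace Formula

variable {AP : Type v} {V : Type w} [DecidableEq V] {S : Type u}

/-- The clauses that all semantics of the `μ`-calculus share. The interpretation `L` of the
literals and the operators `dia'`, `box'` interpreting `◇`, `□` are parameters. -/
def eval (L : S → Set (Lit AP)) (dia' box' : Set S → Set S) :
    Formula AP V → (V → Set S) → Set S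
  | top, _ => Set.univ
  | bot, _ => ∅
  | lit l, _ => {s | l ∈ L s}
  | var X, η => η X
  | and φ ψ, η => φ.eval L dia' box' η ∩ ψ.eval L dia' box' η
  | or φ ψ, η => φ.eval L dia' box' η ∪ ψ.eval L dia' box' η
  | box φ, η => box' (φ.eval L dia' box' η)
  | dia φ, η => dia' (φ.eval L dia' box' η)
  | nu X φ, η => gfpSet fun U => φ.eval L dia' box' (Function.update η X U)
  | mu X φ, η => lfpSet fun U => φ.eval L dia' box' (Function.update η X U)

/-- The semantics is monotone in the environment, so that `mu` and `nu` are interpreted by the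
least and greatest fixpoints (`lfpSet_isLeast`, `gfpSet_isGreatest`). -/
theorem eval_mono {L : S → Set (Lit AP)} {dia' box' : Set S → Set S}
    (hd : Monotone dia') (hb : Monotone box') (φ : Formula AP V) :
    Monotone (φ.eval L dia' box') := by
  induction φ with
  | top => exact fun _ _ _ => le_rfl
  | bot => exact fun _ _ _ => le_rfl
  | lit l => exact fun _ _ _ => le_rfl
  | var X => exact fun _ _ h => h X
  | and φ ψ h₁ h₂ => exact fun _ _ h => Set.inter_subset_inter (h₁ h) (h₂ h)
  | or φ ψ h₁ h₂ => exact fun _ _ h => Set.union_subset_union (h₁ h) (h₂ h)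
  | box φ ih => exact fun _ _ h => hb (ih h)
  | dia φ ih => exact fun _ _ h => hd (ih h)
  | nu X φ ih =>
    exact fun _ _ h => gfpSet_mono fun U => ih (update_le_update_iff.2
      ⟨le_rfl, fun j _ => h j⟩)
  | mu X φ ih =>
    exact fun _ _ h => lfpSet_mono fun U => ih (update_le_update_iff.2
      ⟨le_rfl, fun j _ => h j⟩)

end Formula

/-- Kripke structures (not necessarily finite, with arbitrarily many initial states). -/
structure KS (AP : Type v) : Type (max (u + 1) v) where
  State : Type u
  init : Set State
  trans : State → State → Prop
  label : State → Set (Lit AP)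
  label_exact : ∀ s p, Xor (Lit.pos p ∈ label s) (Lit.neg p ∈ label s)

/-- Generalised Kripke modal transition systems, with may transitions and must
hypertransitions. Finiteness of the state space is imposed separately, where models are
quantified over. -/
structure GTS (AP : Type v) : Type (max (u + 1) v) where
  State : Type u
  init : Set State
  must : State → Set State → Prop
  may : State → State → Prop
  label : State → Set (Lit AP)
  may_of_must : ∀ s A, must s A → ∀ t ∈ A, may s t
  label_consistent : ∀ s p, ¬ (Lit.pos p ∈ label s ∧ Lit.neg p ∈ label s)

variable {AP : Type v} {V : Type w}

/-- A Kripke structure seen as a generalised Kripke modal transition system. -/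
def KS.toGTS (K : KS.{u} AP) : GTS.{u} AP where
  State := K.State
  init := K.init
  must s A := ∃ t, K.trans s t ∧ A = {t}
  may := K.trans
  label := K.label
  may_of_must := by
    rintro s A ⟨t, h, rfl⟩ t' rfl
    exact h
  label_consistent := fun s p h => by
    rcases K.label_exact s p with h' | h'
    · exact h'.2 h.2
    · exact h'.2 h.1

/-- Mixed simulations between two generalised Kripke modal transition systems. -/
def IsMixedSim (M₁ M₂ : GTS.{u} AP) (H : M₁.State → M₂.State → Prop) : Prop :=
  ∀ s₁ s₂, H s₁ s₂ →
    M₂.label s₂ ⊆ M₁.label s₁ ∧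
    (∀ t₁, M₁.may s₁ t₁ → ∃ t₂, M₂.may s₂ t₂ ∧ H t₁ t₂) ∧
    (∀ A₂, M₂.must s₂ A₂ → ∃ A₁, M₁.must s₁ A₁ ∧ ∀ t₁ ∈ A₁, ∃ t₂ ∈ A₂, H t₁ t₂)

/-- `⟨M₁, s₁⟩ ≤_mix ⟨M₂, s₂⟩`. -/
def MixLEAt (M₁ : GTS.{u} AP) (s₁ : M₁.State) (M₂ : GTS.{u} AP) (s₂ : M₂.State) : Prop :=
  ∃ H, IsMixedSim M₁ M₂ H ∧ H s₁ s₂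

/-- `M₁ ≤_mix M₂`. -/
def MixLE (M₁ M₂ : GTS.{u} AP) : Prop :=
  ∀ s₁ ∈ M₁.init, ∃ s₂ ∈ M₂.init, MixLEAt M₁ s₁ M₂ s₂

section Semantics

variable [DecidableEq V]

/-- The standard semantics of the `μ`-calculus in a Kripke structure. -/
def KS.sem (K : KS.{u} AP) (φ : Formula AP V) (η : V → Set K.State) : Set K.State :=
  φ.eval K.label
    (fun U => {s | ∃ t, K.trans s t ∧ t ∈ U})
    (fun U => {s | ∀ t, K.trans s t → t ∈ U}) η

/-- `⟨K, s⟩ ⊨ φ`. For closed `φ` the environment is irrelevant. -/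
def KS.SatAt (K : KS.{u} AP) (s : K.State) (φ : Formula AP V) : Prop :=
  ∀ η, s ∈ K.sem φ η

/-- `K ⊨ φ`: the formula is true in all initial states. -/
def KS.Sat (K : KS.{u} AP) (φ : Formula AP V) : Prop :=
  ∀ s ∈ K.init, K.SatAt s φ

/-- The "true" part of the standard inductive semantics (SIS): the states in which the formula
is proved. -/
def GTS.semTrue (M : GTS.{u} AP) (φ : Formula AP V) (η : V → Set M.State) : Set M.State :=
  φ.eval M.label
    (fun U => {s | ∃ A, M.must s A ∧ A ⊆ U})
    (fun U => {s | ∀ t, M.may s t → t ∈ U}) η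

/-- `⟨M, s⟩ ⊨ φ` in the standard inductive semantics. -/
def GTS.SatAt (M : GTS.{u} AP) (s : M.State) (φ : Formula AP V) : Prop :=
  ∀ η, s ∈ M.semTrue φ η

/-- `M ⊨ φ` in the standard inductive semantics: `φ` is proved in all initial states. -/
def GTS.Sat (M : GTS.{u} AP) (φ : Formula AP V) : Prop :=
  ∀ s ∈ M.init, M.SatAt s φ

/-- Semantic equivalence: truth in the same Kripke structures. -/
def SemEquiv (φ ψ : Formula AP V) : Prop :=
  ∀ K : KS.{u} AP, K.Sat φ ↔ K.Sat ψ

/-- The `μ`-calculus: the closed formulas. -/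
def Lmu (AP : Type v) (V : Type w) : Set (Formula AP V) := {φ | φ.Closed}

/-- The fragment of the `μ`-calculus in which only the greatest fixpoint is allowed. -/
def LmuNu (AP : Type v) (V : Type w) : Set (Formula AP V) := {φ | φ.Closed ∧ φ.MuFree}

/-- The completion of a sublanguage with respect to semantic equivalence. -/
def semCompletion (L : Set (Formula AP V)) : Set (Formula AP V) :=
  {φ | φ ∈ Lmu AP V ∧ ∃ ψ ∈ L, SemEquiv.{u} φ ψ}

/-- The completeness set of the abstraction formalism of (finite) GTSs: the satisfiable formulas
for which each Kripke structure and state satisfying the formula has a finite abstraction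
proving it. -/
def complGTS (AP : Type v) (V : Type w) [DecidableEq V] : Set (Formula AP V) :=
  {φ | φ ∈ Lmu AP V ∧
    (∃ (K : KS.{u} AP) (s : K.State), K.SatAt s φ) ∧
    ∀ (K : KS.{u} AP) (s : K.State), K.SatAt s φ →
      ∃ (M : GTS.{u} AP) (t : M.State),
        Finite M.State ∧ MixLEAt K.toGTS s M t ∧ M.SatAt t φ}

open Classical in
/-- The minimal size of a GTS that abstracts `K` and proves `φ`; it is `∞` if there is none, and
also, by convention, if `φ` is not in the completeness set. -/
noncomputable def minmodelGTS (φ : Formula AP V) (K : KS.{u} AP) : ℕ∞ :=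
  if φ ∈ complGTS.{u} AP V then
    sInf {n | ∃ M : GTS.{u} AP,
      Finite M.State ∧ MixLE K.toGTS M ∧ M.Sat φ ∧ n = ENat.card M.State}
  else ⊤

/-- The supremum of `minmodelGTS φ K` over all Kripke structures `K` satisfying `φ`. -/
noncomputable def maxminmodelGTS (φ : Formula AP V) : ℕ∞ :=
  sSup {n | ∃ K : KS.{u} AP, K.Sat φ ∧ n = minmodelGTS φ K}

end Semantics

end MuCalc

/-! By contraposition. Suppose abstractions with at most `n` states suffice for `φ`. Proving `φ`
involves only the finitely many literals of `φ`, so up to renaming of states an abstraction is one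
of finitely many patterns on `Fin m`, `m ≤ n`. Being simulated by a given state of a finite pattern
is a greatest fixpoint property, hence expressible without `mu` (`exists_charFormula`). Take the
disjunction of these characteristic formulas over the pairs (pattern, state) all of whose simulated
Kripke states satisfy `φ`. It implies `φ` by choice of the pairs. Conversely, an abstraction proving
`φ` contributes such a pair, because mixed simulations preserve what is proved
(`GTS.mem_sem_of_mem_semTrue`). So `φ` is equivalent to a formula without `mu`. -/

namespace MuCalc

/-! ### Occurring literals; finite conjunctions and disjunctions -/

namespace Formula

variable {AP : Type v} {V : Type w}

/-- The literals that occur in a formula. -/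
def lits : Formula AP V → Set (Lit AP)
  | top => ∅
  | bot => ∅
  | lit l => {l}
  | var _ => ∅
  | and φ ψ => φ.lits ∪ ψ.lits
  | or φ ψ => φ.lits ∪ ψ.lits
  | box φ => φ.lits
  | dia φ => φ.lits
  | nu _ φ => φ.lits
  | mu _ φ => φ.lits

theorem finite_lits (φ : Formula AP V) : φ.lits.Finite := by
  induction φ with
  | top | bot | var => exact Set.finite_empty
  | lit l => exact Set.finite_singleton l
  | and φ ψ h₁ h₂ | or φ ψ h₁ h₂ => exact h₁.union h₂
  | box φ ih | dia φ ih | nu _ φ ih | mu _ φ ih => exact ih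

/-- The disjunction of a list of formulas. -/
def listOr : List (Formula AP V) → Formula AP V
  | [] => bot
  | φ :: l => or φ (listOr l)

/-- The conjunction of a list of formulas. -/
def listAnd : List (Formula AP V) → Formula AP V
  | [] => top
  | φ :: l => and φ (listAnd l)

theorem freeVars_listOr_subset {E : Set V} {l : List (Formula AP V)}
    (h : ∀ φ ∈ l, φ.freeVars ⊆ E) : (listOr l).freeVars ⊆ E := by
  induction l with
  | nil => exact Set.empty_subset E
  | cons φ l ih =>
    rw [List.forall_mem_cons] at h
    exact Set.union_subset h.1 (ih h.2)

theorem freeVars_listAnd_subset {E : Set V} {l : List (Formula AP V)}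
    (h : ∀ φ ∈ l, φ.freeVars ⊆ E) : (listAnd l).freeVars ⊆ E := by
  induction l with
  | nil => exact Set.empty_subset E
  | cons φ l ih =>
    rw [List.forall_mem_cons] at h
    exact Set.union_subset h.1 (ih h.2)

theorem muFree_listOr {l : List (Formula AP V)} (h : ∀ φ ∈ l, φ.MuFree) :
    (listOr l).MuFree := by
  induction l with
  | nil => trivial
  | cons φ l ih =>
    rw [List.forall_mem_cons] at h
    exact ⟨h.1, ih h.2⟩

theorem muFree_listAnd {l : List (Formula AP V)} (h : ∀ φ ∈ l, φ.MuFree) :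
    (listAnd l).MuFree := by
  induction l with
  | nil => trivial
  | cons φ l ih =>
    rw [List.forall_mem_cons] at h
    exact ⟨h.1, ih h.2⟩

/-- The elements of a finite type, as a list. -/
noncomputable def elems (ι : Type*) [Finite ι] : List ι :=
  (Set.finite_univ (α := ι)).toFinset.toList

theorem mem_elems {ι : Type*} [Finite ι] (i : ι) : i ∈ elems ι := by
  simp [elems]

/-- The disjunction of a finite family of formulas. -/
noncomputable def bigOr {ι : Type*} [Finite ι] (f : ι → Formula AP V) : Formula AP V :=
  listOr ((elems ι).map f)

/-- The conjunction of a finite family of formulas. -/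
noncomputable def bigAnd {ι : Type*} [Finite ι] (f : ι → Formula AP V) : Formula AP V :=
  listAnd ((elems ι).map f)

section Families

variable {ι : Type*} [Finite ι] {f : ι → Formula AP V}

theorem freeVars_bigOr_subset {E : Set V} (h : ∀ i, (f i).freeVars ⊆ E) :
    (bigOr f).freeVars ⊆ E :=
  freeVars_listOr_subset (List.forall_mem_map.2 fun i _ => h i)

theorem freeVars_bigAnd_subset {E : Set V} (h : ∀ i, (f i).freeVars ⊆ E) :
    (bigAnd f).freeVars ⊆ E :=
  freeVars_listAnd_subset (List.forall_mem_map.2 fun i _ => h i)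

theorem muFree_bigOr (h : ∀ i, (f i).MuFree) : (bigOr f).MuFree :=
  muFree_listOr (List.forall_mem_map.2 fun i _ => h i)

theorem muFree_bigAnd (h : ∀ i, (f i).MuFree) : (bigAnd f).MuFree :=
  muFree_listAnd (List.forall_mem_map.2 fun i _ => h i)

variable [DecidableEq V] {S : Type u} {L : S → Set (Lit AP)} {dia' box' : Set S → Set S}
  {η : V → Set S} {s : S}

theorem mem_eval_listOr {l : List (Formula AP V)} :
    s ∈ (listOr l).eval L dia' box' η ↔ ∃ φ ∈ l, s ∈ φ.eval L dia' box' η := by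
  induction l with
  | nil => simp [listOr, eval]
  | cons φ l ih => simp [listOr, eval, ih]

theorem mem_eval_listAnd {l : List (Formula AP V)} :
    s ∈ (listAnd l).eval L dia' box' η ↔ ∀ φ ∈ l, s ∈ φ.eval L dia' box' η := by
  induction l with
  | nil => simp [listAnd, eval]
  | cons φ l ih => simp [listAnd, eval, ih]

theorem mem_eval_bigOr :
    s ∈ (bigOr f).eval L dia' box' η ↔ ∃ i, s ∈ (f i).eval L dia' box' η := by
  simp [bigOr, mem_eval_listOr, mem_elems]

theorem mem_eval_bigAnd :
    s ∈ (bigAnd f).eval L dia' box' η ↔ ∀ i, s ∈ (f i).eval L dia' box' η := by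
  simp [bigAnd, mem_eval_listAnd, mem_elems]

end Families

end Formula

variable {AP : Type v} {V : Type w}

/-! ### Finite patterns and the one-step simulation condition -/

/-- The transition and labelling data of a generalised Kripke modal transition system with states
`σ`, in which only the literals in `Λ` are recorded. -/
structure Pattern (σ : Type*) (Λ : Set (Lit AP)) where
  must : σ → Set σ → Prop
  may : σ → σ → Prop
  label : σ → Set Λ

instance {σ : Type*} {Λ : Set (Lit AP)} [Finite σ] [Finite Λ] : Finite (Pattern σ Λ) :=
  Finite.of_injective
    (fun D : Pattern σ Λ => (D.must, D.may, D.label))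
    (by
      rintro ⟨a, b, c⟩ ⟨a', b', c'⟩ h
      simp only [Prod.mk.injEq] at h
      obtain ⟨rfl, rfl, rfl⟩ := h
      rfl)

namespace Pattern

variable {σ : Type*} {Λ : Set (Lit AP)}

/-- The condition that a mixed simulation `H` has to satisfy at a related pair of states. -/
def Step (D : Pattern σ Λ) (K : KS.{u} AP) (H : K.State → σ → Prop) (k : K.State) (s : σ) :
    Prop :=
  (∀ l : Λ, l ∈ D.label s → l.1 ∈ K.label k) ∧
  (∀ k', K.trans k k' → ∃ t, D.may s t ∧ H k' t) ∧
  (∀ A, D.must s A → ∃ k', K.trans k k' ∧ ∃ t ∈ A, H k' t)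

theorem Step.mono {D : Pattern σ Λ} {K : KS.{u} AP} {H H' : K.State → σ → Prop}
    (hH : ∀ k s, H k s → H' k s) {k : K.State} {s : σ} (h : D.Step K H k s) :
    D.Step K H' k s :=
  ⟨h.1, fun k' hk' => (h.2.1 k' hk').imp fun t ht => ⟨ht.1, hH k' t ht.2⟩,
    fun A hA => (h.2.2 A hA).imp fun k' hk' => ⟨hk'.1, hk'.2.imp fun t ht => ⟨ht.1, hH k' t ht.2⟩⟩⟩

/-- The formula expressing `Pattern.Step`, where `f t` describes the states related to `t`. -/
noncomputable def stepFormula [Finite σ] [Finite Λ] (D : Pattern σ Λ) (f : σ → Formula AP V)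
    (s : σ) : Formula AP V :=
  .and (.bigAnd fun l : D.label s => .lit l.1.1)
    (.and (.box (.bigOr fun t : {t // D.may s t} => f t))
      (.bigAnd fun A : {A // D.must s A} => .dia (.bigOr fun t : A.1 => f t)))

section StepFormula

variable [Finite σ] [Finite Λ] {D : Pattern σ Λ} {f : σ → Formula AP V} {s : σ}

theorem muFree_stepFormula (h : ∀ t, (f t).MuFree) : (D.stepFormula f s).MuFree :=
  ⟨Formula.muFree_bigAnd fun _ => trivial, Formula.muFree_bigOr fun _ => h _,
    Formula.muFree_bigAnd fun A =>
      show (Formula.bigOr fun t : A.1 => f t).MuFree from Formula.muFree_bigOr fun _ => h _⟩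

theorem freeVars_stepFormula_subset {E : Set V} (h : ∀ t, (f t).freeVars ⊆ E) :
    (D.stepFormula f s).freeVars ⊆ E :=
  Set.union_subset (Formula.freeVars_bigAnd_subset fun _ => Set.empty_subset E)
    (Set.union_subset (Formula.freeVars_bigOr_subset (f := fun t : {t // D.may s t} => f t)
        fun _ => h _)
      (Formula.freeVars_bigAnd_subset fun A =>
        show (Formula.bigOr fun t : A.1 => f t).freeVars ⊆ E from
          Formula.freeVars_bigOr_subset fun _ => h _))

theorem mem_sem_stepFormula [DecidableEq V] {K : KS.{u} AP} {η : V → Set K.State} {k : K.State} :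
    k ∈ K.sem (D.stepFormula f s) η ↔ D.Step K (fun k t => k ∈ K.sem (f t) η) k s := by
  simp only [stepFormula, KS.sem, Formula.eval, Set.mem_inter_iff, Formula.mem_eval_bigAnd,
    Formula.mem_eval_bigOr, Set.mem_ofPred_eq, Step, Subtype.forall, Subtype.exists, exists_prop]

end StepFormula

/-! ### Characteristic formulas of pattern states -/

open Classical in
/-- The formula describing the states that are simulated by `s`, in which the variables `X t`
for `t ∈ E` are used as parameters. The argument `n` bounds the nesting depth. -/
noncomputable def charFormula [Finite σ] [Finite Λ] (D : Pattern σ Λ) (X : σ → V) :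
    ℕ → Set σ → σ → Formula AP V
  | 0, E, s => if s ∈ E then .var (X s) else .top
  | n + 1, E, s =>
    if s ∈ E then .var (X s)
    else .nu (X s) (D.stepFormula (charFormula D X n (insert s E)) s)

section SimRel

variable {D : Pattern σ Λ} {X : σ → V}

/-- `H` is a mixed simulation, except that the states related to `t ∈ E` are only required to
belong to `η (X t)`. -/
def IsSimRel (D : Pattern σ Λ) (X : σ → V) (K : KS.{u} AP) (η : V → Set K.State) (E : Set σ)
    (H : K.State → σ → Prop) : Prop :=
  ∀ k s, H k s → (s ∈ E → k ∈ η (X s)) ∧ (s ∉ E → D.Step K H k s)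

/-- The greatest relation that satisfies `IsSimRel`. -/
def SimRel (D : Pattern σ Λ) (X : σ → V) (K : KS.{u} AP) (η : V → Set K.State) (E : Set σ)
    (k : K.State) (s : σ) : Prop :=
  ∃ H, D.IsSimRel X K η E H ∧ H k s

theorem isSimRel_simRel (K : KS.{u} AP) (η : V → Set K.State) (E : Set σ) :
    D.IsSimRel X K η E (D.SimRel X K η E) := by
  rintro k s ⟨H, hH, hks⟩
  exact ⟨(hH k s hks).1, fun hs => ((hH k s hks).2 hs).mono fun _ _ h => ⟨H, hH, h⟩⟩

/-- At a parameter state nothing is required of successors, so the single pair `(k, s)` is already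
an admissible relation. -/
theorem simRel_iff_of_mem {K : KS.{u} AP} {η : V → Set K.State} {E : Set σ} {k : K.State}
    {s : σ} (hs : s ∈ E) : D.SimRel X K η E k s ↔ k ∈ η (X s) := by
  refine ⟨fun h => (isSimRel_simRel K η E k s h).1 hs, fun h =>
    ⟨fun k' t => k' = k ∧ t = s, ?_, rfl, rfl⟩⟩
  rintro _ _ ⟨rfl, rfl⟩
  exact ⟨fun _ => h, fun h' => absurd hs h'⟩

end SimRel

section CharFormula

variable [Finite σ] [Finite Λ] (D : Pattern σ Λ) (X : σ → V)

theorem muFree_charFormula (n : ℕ) (E : Set σ) (s : σ) : (D.charFormula X n E s).MuFree := by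
  induction n generalizing E s with
  | zero => unfold charFormula; split_ifs <;> trivial
  | succ n ih =>
    unfold charFormula
    split_ifs
    · trivial
    · exact muFree_stepFormula fun t => ih _ t

theorem freeVars_charFormula_subset (n : ℕ) (E : Set σ) (s : σ) :
    (D.charFormula X n E s).freeVars ⊆ X '' E := by
  induction n generalizing E s with
  | zero =>
    unfold charFormula
    split_ifs with h
    · exact Set.singleton_subset_iff.2 (Set.mem_image_of_mem X h)
    · exact Set.empty_subset _
  | succ n ih =>
    unfold charFormula
    split_ifs with h
    · exact Set.singleton_subset_iff.2 (Set.mem_image_of_mem X h)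
    · refine Set.sdiff_subset_iff.2 ((freeVars_stepFormula_subset fun t => ih _ t).trans ?_)
      rw [Set.image_insert_eq, Set.singleton_union]

variable {D X}

/-- Bekić's principle: the simultaneous greatest fixpoint over all states is unravelled into nested
`nu`s. Each `nu` moves one state into `E`, so the number of states outside `E` bounds the depth
needed. -/
theorem mem_sem_charFormula [DecidableEq V] (hX : Function.Injective X) (K : KS.{u} AP) (n : ℕ)
    (E : Set σ) (hE : Eᶜ.ncard ≤ n) (η : V → Set K.State) (k : K.State) (s : σ) :
    k ∈ K.sem (D.charFormula X n E s) η ↔ D.SimRel X K η E k s := by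
  induction n generalizing E η k s with
  | zero =>
    -- No state is left outside `E`, so the default `top` is never reached.
    have hs : s ∈ E := by
      by_contra hs
      rw [Nat.le_zero, Set.ncard_eq_zero] at hE
      exact (hE ▸ hs : s ∈ (∅ : Set σ))
    rw [simRel_iff_of_mem hs, charFormula, if_pos hs]
    rfl
  | succ n ih =>
    by_cases hs : s ∈ E
    · rw [simRel_iff_of_mem hs, charFormula, if_pos hs]
      rfl
    rw [charFormula, if_neg hs]
    have hE' : (insert s E)ᶜ.ncard ≤ n := by
      have : (insert s E)ᶜ ⊂ Eᶜ :=
        compl_lt_compl_iff_lt.2 (Set.ssubset_insert hs)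
      have := Set.ncard_lt_ncard this
      omega
    have key : ∀ U : Set K.State, ∀ k,
        k ∈ K.sem (D.stepFormula (D.charFormula X n (insert s E)) s) (Function.update η (X s) U) ↔
          D.Step K (D.SimRel X K (Function.update η (X s) U) (insert s E)) k s := by
      intro U k
      simp only [mem_sem_stepFormula, ih _ hE']
    have hne : ∀ t ∈ E, ∀ U : Set K.State, Function.update η (X s) U (X t) = η (X t) := by
      intro t ht U
      exact Function.update_of_ne (fun h => hs ((hX h : t = s) ▸ ht)) _ _
    constructor
    · rintro ⟨U, hU, hk⟩
      -- The relation with `s` frozen to the post-fixpoint `U` is admissible for `E` too: at `s` the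
      -- step condition is `U ⊆ f U`.
      refine ⟨D.SimRel X K (Function.update η (X s) U) (insert s E), ?_, ?_⟩
      · intro k' t hkt
        refine ⟨fun ht => ?_, fun ht => ?_⟩
        · rw [simRel_iff_of_mem (Set.mem_insert_of_mem s ht), hne t ht] at hkt
          exact hkt
        · by_cases hts : t = s
          · subst hts
            rw [simRel_iff_of_mem (Set.mem_insert t E), Function.update_self] at hkt
            exact (key U k').1 (hU hkt)
          · exact (isSimRel_simRel K _ _ k' t hkt).2 fun h => (Set.mem_insert_iff.1 h).elim hts ht
      · rw [simRel_iff_of_mem (Set.mem_insert s E), Function.update_self]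
        exact hk
    · intro hk
      -- The slice at `s` of the greatest relation is a post-fixpoint; with `s` frozen to it, that
      -- same relation remains admissible.
      refine ⟨{k | D.SimRel X K η E k s}, fun k' hk' => ?_, hk⟩
      refine (key _ k').2 (((isSimRel_simRel K η E k' s hk').2 hs).mono fun j t hjt =>
        ⟨D.SimRel X K η E, fun j' t' h => ⟨fun ht' => ?_, fun ht' => ?_⟩, hjt⟩)
      · rcases Set.mem_insert_iff.1 ht' with rfl | ht'
        · rw [Function.update_self]
          exact h
        · rw [hne t' ht']
          exact (isSimRel_simRel K η E j' t' h).1 ht'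
      · exact (isSimRel_simRel K η E j' t' h).2 fun h' => ht' (Set.mem_insert_of_mem s h')

end CharFormula

/-- The state `k` of `K` is related to `s` by a mixed simulation. -/
def Simulates (D : Pattern σ Λ) (K : KS.{u} AP) (k : K.State) (s : σ) : Prop :=
  ∃ H : K.State → σ → Prop, (∀ k s, H k s → D.Step K H k s) ∧ H k s

/-- Similarity with a state of a finite pattern is definable by a closed formula without least
fixpoints. -/
theorem exists_charFormula [Finite σ] [Finite Λ] [DecidableEq V] [Infinite V] (D : Pattern σ Λ)
    (s : σ) : ∃ χ ∈ LmuNu AP V, ∀ (K : KS.{u} AP) (k : K.State) (η : V → Set K.State),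
      k ∈ K.sem χ η ↔ D.Simulates K k s := by
  obtain ⟨n, ⟨e⟩⟩ := Finite.exists_equiv_fin σ
  let X : σ → V := fun t => Infinite.natEmbedding V (e t)
  have hX : Function.Injective X := fun a b h =>
    e.injective (Fin.ext ((Infinite.natEmbedding V).injective h))
  refine ⟨D.charFormula X ((∅ : Set σ)ᶜ.ncard) ∅ s, ⟨?_, D.muFree_charFormula X _ _ _⟩, ?_⟩
  · exact Set.subset_empty_iff.1
      ((D.freeVars_charFormula_subset X _ _ _).trans (Set.image_empty X).subset)
  · intro K k η
    rw [mem_sem_charFormula hX K _ _ le_rfl]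
    simp [SimRel, IsSimRel, Simulates]

end Pattern

/-! ### Preservation of proved formulas under simulation -/

/-- The pattern of a generalised Kripke modal transition system, with states renamed. -/
def GTS.pattern (M : GTS.{u} AP) {σ : Type*} (e : M.State ≃ σ) (Λ : Set (Lit AP)) :
    Pattern σ Λ where
  must s A := M.must (e.symm s) (e ⁻¹' A)
  may s t := M.may (e.symm s) (e.symm t)
  label s := {l | l.1 ∈ M.label (e.symm s)}

section Preservation

variable {M : GTS.{u} AP} {σ : Type*} {e : M.State ≃ σ} {Λ : Set (Lit AP)}

theorem GTS.simulates_pattern {K : KS.{u} AP} {k : K.State} {t : M.State}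
    (h : MixLEAt K.toGTS k M t) : (M.pattern e Λ).Simulates K k (e t) := by
  obtain ⟨H, hH, hkt⟩ := h
  refine ⟨fun k s => H k (e.symm s), fun k s hks => ?_, by simpa using hkt⟩
  obtain ⟨h₁, h₂, h₃⟩ := hH k (e.symm s) hks
  refine ⟨fun l hl => h₁ hl, fun k' hk' => ?_, fun A hA => ?_⟩
  · obtain ⟨t₂, ht, hH'⟩ := h₂ k' hk'
    exact ⟨e t₂, by simpa [GTS.pattern] using ht, by simpa using hH'⟩
  · obtain ⟨_, ⟨k', hk', rfl⟩, hA'⟩ := h₃ _ hA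
    obtain ⟨t₂, ht, hH'⟩ := hA' k' rfl
    exact ⟨k', hk', e t₂, ht, by simpa using hH'⟩

variable [DecidableEq V]

/-- Mixed simulations preserve the formulas that are proved, also in the presence of free
variables. -/
theorem GTS.mem_sem_of_mem_semTrue {K : KS.{u} AP} {H : K.State → σ → Prop}
    (hH : ∀ k s, H k s → (M.pattern e Λ).Step K H k s) (φ : Formula AP V) (hφ : φ.lits ⊆ Λ)
    {η : V → Set K.State} {ρ : V → Set M.State}
    (hη : ∀ X k t, t ∈ ρ X → H k (e t) → k ∈ η X) {k : K.State} {t : M.State}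
    (ht : t ∈ M.semTrue φ ρ) (hkt : H k (e t)) : k ∈ K.sem φ η := by
  induction φ generalizing η ρ k t with
  | top => trivial
  | bot => exact ht
  | lit l =>
    refine (hH _ _ hkt).1 ⟨l, hφ rfl⟩ ?_
    change l ∈ M.label (e.symm (e t))
    rwa [e.symm_apply_apply]
  | var X => exact hη X k t ht hkt
  | and φ ψ h₁ h₂ =>
    obtain ⟨hφ₁, hφ₂⟩ := Set.union_subset_iff.1 hφ
    exact ⟨h₁ hφ₁ hη ht.1 hkt, h₂ hφ₂ hη ht.2 hkt⟩
  | or φ ψ h₁ h₂ =>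
    obtain ⟨hφ₁, hφ₂⟩ := Set.union_subset_iff.1 hφ
    exact ht.imp (fun ht => h₁ hφ₁ hη ht hkt) (fun ht => h₂ hφ₂ hη ht hkt)
  | box φ ih =>
    intro k' hk'
    obtain ⟨s, hs, hk's⟩ := (hH _ _ hkt).2.1 k' hk'
    refine ih hφ hη (ht (e.symm s) ?_) (by simpa using hk's)
    simpa [GTS.pattern] using hs
  | dia φ ih =>
    obtain ⟨A, hA, hAφ⟩ := ht
    obtain ⟨k', hk', s, hs, hk's⟩ := (hH _ _ hkt).2.2 (e '' A) (by
      simpa [GTS.pattern, Set.preimage_image_eq _ e.injective] using hA)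
    obtain ⟨t', ht', rfl⟩ := hs
    exact ⟨k', hk', ih hφ hη (hAφ ht') hk's⟩
  | nu X φ ih =>
    obtain ⟨U, hU, htU⟩ := ht
    -- A post-fixpoint is pushed forward along `H`.
    refine ⟨{k | ∃ t ∈ U, H k (e t)}, ?_, t, htU, hkt⟩
    rintro k' ⟨t', ht', hk't'⟩
    refine ih hφ (fun Y j r hr hjr => ?_) (hU ht') hk't'
    by_cases hY : Y = X
    · subst hY
      rw [Function.update_self] at hr ⊢
      exact ⟨r, hr, hjr⟩
    · rw [Function.update_of_ne hY] at hr ⊢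
      exact hη Y j r hr hjr
  | mu X φ ih =>
    intro U hU
    -- Dually, a pre-fixpoint is pulled back: keep the `t` all of whose related states lie in `U`.
    refine ht {t | ∀ k, H k (e t) → k ∈ U} (fun t' ht' k' hk' => hU ?_) k hkt
    refine ih hφ (fun Y j r hr hjr => ?_) ht' hk'
    by_cases hY : Y = X
    · subst hY
      rw [Function.update_self] at hr ⊢
      exact hr j hjr
    · rw [Function.update_of_ne hY] at hr ⊢
      exact hη Y j r hr hjr

theorem GTS.SatAt.satAt_of_simulates {K : KS.{u} AP} {k : K.State} {t : M.State}
    {φ : Formula AP V} (hφ : φ.lits ⊆ Λ) (h : M.SatAt t φ)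
    (hk : (M.pattern e Λ).Simulates K k (e t)) : K.SatAt k φ := by
  obtain ⟨H, hH, hkt⟩ := hk
  exact fun η => GTS.mem_sem_of_mem_semTrue hH φ hφ
    -- The largest environment on `M` compatible with `η`.
    (ρ := fun X => {t | ∀ k, H k (e t) → k ∈ η X}) (fun X k t ht => ht k) (h _) hkt

end Preservation

/-! ### Bounded abstractions eliminate least fixpoints -/

/-- A formula that is proved, for each Kripke structure satisfying it, by an abstraction of
bounded size is equivalent to a formula without least fixpoints. -/
theorem mem_semCompletion_of_bounded [DecidableEq V] [Infinite V] {φ : Formula AP V}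
    (hφ : φ ∈ Lmu AP V) (n : ℕ)
    (h : ∀ K : KS.{u} AP, K.Sat φ → ∃ M : GTS.{u} AP,
      Finite M.State ∧ MixLE K.toGTS M ∧ M.Sat φ ∧ Nat.card M.State ≤ n) :
    φ ∈ semCompletion.{u} (LmuNu AP V) := by
  have : Finite φ.lits := φ.finite_lits
  -- Soundness is built into the index type, which is finite because `m ≤ n` and `φ.lits` is finite.
  let ι := {i : Σ m : Fin (n + 1), Pattern (Fin m) φ.lits × Fin m //
    ∀ (K : KS.{u} AP) (k : K.State), i.2.1.Simulates K k i.2.2 → K.SatAt k φ}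
  choose χ hχ hχsem using fun i : ι => i.1.2.1.exists_charFormula.{u} (V := V) i.1.2.2
  refine ⟨hφ, .bigOr χ, ⟨?_, Formula.muFree_bigOr fun i => (hχ i).2⟩, fun K => ⟨?_, ?_⟩⟩
  · exact Set.subset_empty_iff.1 (Formula.freeVars_bigOr_subset fun i => (hχ i).1.subset)
  · intro hK k hk η
    obtain ⟨M, hfin, hKM, hM, hcard⟩ := h K hK
    obtain ⟨t, ht, hkt⟩ := hKM k hk
    let e : M.State ≃ Fin (Nat.card M.State) := Finite.equivFin M.State
    refine Formula.mem_eval_bigOr.2 ⟨⟨⟨⟨Nat.card M.State, Nat.lt_succ_of_le hcard⟩,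
      M.pattern e φ.lits, e t⟩, fun K' k' hk' => ?_⟩, ?_⟩
    · exact (hM t ht).satAt_of_simulates subset_rfl hk'
    · exact (hχsem _ K k η).2 (GTS.simulates_pattern hkt)
  · intro hK k hk η
    obtain ⟨i, hi⟩ := Formula.mem_eval_bigOr.1 (hK k hk η)
    exact i.2 K k ((hχsem i K k η).1 hi) η

end MuCalc

/-- The second conjunct says that, even without the convention on formulas outside the
completeness set, no uniform bound on the size of the abstractions proving `φ` suffices. -/
theorem mainTheorem7 {AP : Type v} {V : Type w} [DecidableEq V] [Infinite V]
    (φ : MuCalc.Formula AP V)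
    (hφ : φ ∈ MuCalc.Lmu AP V \ MuCalc.semCompletion.{u} (MuCalc.LmuNu AP V)) :
    MuCalc.maxminmodelGTS.{u} φ = ⊤ ∧
    ∀ n : ℕ, ∃ K : MuCalc.KS.{u} AP, K.Sat φ ∧
      ∀ M : MuCalc.GTS.{u} AP, Finite M.State → MuCalc.MixLE K.toGTS M → M.Sat φ →
        n < Nat.card M.State := by
  have main : ∀ n : ℕ, ∃ K : MuCalc.KS.{u} AP, K.Sat φ ∧
      ∀ M : MuCalc.GTS.{u} AP, Finite M.State → MuCalc.MixLE K.toGTS M → M.Sat φ →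
        n < Nat.card M.State := by
    intro n
    by_contra! hn
    exact hφ.2 (MuCalc.mem_semCompletion_of_bounded hφ.1 n hn)
  refine ⟨ENat.eq_top_iff_forall_ge.2 fun n => ?_, main⟩
  obtain ⟨K, hK, hn⟩ := main n
  refine le_trans ?_ (le_sSup ⟨K, hK, rfl⟩)
  unfold MuCalc.minmodelGTS
  -- Outside the completeness set the value is `⊤` by convention, so the bound is trivial there.
  split_ifs
  · refine le_sInf ?_
    rintro _ ⟨M, hfin, hKM, hM, rfl⟩
    rw [ENat.card_eq_coe_natCard]
    exact_mod_cast (hn M hfin hKM hM).le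
  · exact le_top
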